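/- Let $E$ be a complex Banach space, $M\ge 1$, $\omega\ge 0$, and let $\{T(t)\}_{t\ge 0}$ be a $C_0$-semigroup of bounded linear operators on $E$ (that is, $T(0)=I$, $T(t+s)=T(t)T(s)$ for $t,s\ge 0$, and $\lim_{t\searrow 0}T(t)x=x$ for all $x\in E$) such that $\|T(t)\|\le Me^{\omega t}$ for all $t\ge 0$. Let $A$ be its infinitesimal generator: $D(A)$ is the set of $x\in E$ for which $\lim_{h\searrow 0}\frac{T(h)x-x}{h}$ exists, and $Ax$ is this limit. The resolvent set $\rho(A)$ is the set of $\lambda\in\mathbb C$ for which $\lambda I-A:D(A)\to E$ is bijective, and $R(\lambda;A)=(\lambda I-A)^{-1}$ for $\lambda\in\rho(A)$; for $t=0$ the operator $I-\frac tn A$ is understood as the identity of $E$. Then, for every $t\ge 0$ and every integer $n>\omega t$, the operator $I-\frac tn A$ is a bijection of its domain onto $E$, and $\frac nt\in\rho(A)$ if $t>0$. Moreover, for every $x\in E$, $$T(t)x=\lim_{n\to\infty}\left(I-\frac tn A\right)^{-n}x\quad(t\ge 0),\qquad T(t)x=\lim_{n\to\infty}\left[\frac nt R\left(\frac nt;A\right)\right]^n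 x\quad(t>0),$$ and for every compact set $K\subset[0,\infty)$ the first limit is uniform in $t\in K$ and the second is uniform in $t\in K\setminus\{0\}$. -/

import Mathlib

open Filter Topology Set

/-- A `C₀`-semigroup `{T(t)}_{t ≥ 0}` of bounded linear operators on `E`.
Only the values `T t` with `t ≥ 0` matter. -/
structure IsC0Semigroup {E : Type*} [NormedAddCommGroup E] [NormedSpace ℂ E]
    (T : ℝ → E →L[ℂ] E) : Prop where
  map_zero : T 0 = ContinuousLinearMap.id ℂ E
  map_add : ∀ t s : ℝ, 0 ≤ t → 0 ≤ s → T (t + s) = (T t).comp (T s)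
  tendsto_zero : ∀ x : E, Tendsto (fun t : ℝ => T t x) (𝓝[>] 0) (𝓝 x)

/-- The class `SG(M, ω)`: the `C₀`-semigroups with `‖T(t)‖ ≤ M e^{ω t}` for all `t ≥ 0`,
where `M ≥ 1` and `ω ≥ 0`. -/
structure IsSG {E : Type*} [NormedAddCommGroup E] [NormedSpace ℂ E]
    (M ω : ℝ) (T : ℝ → E →L[ℂ] E) : Prop where
  isC0Semigroup : IsC0Semigroup T
  one_le : 1 ≤ M
  nonneg : 0 ≤ ω
  norm_le : ∀ t : ℝ, 0 ≤ t → ‖T t‖ ≤ M * Real.exp (ω * t)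

/-- `y` is the limit of `(T(h)x - x)/h` as `h ↘ 0`. -/
def HasGeneratorLimit {E : Type*} [NormedAddCommGroup E] [NormedSpace ℂ E]
    (T : ℝ → E →L[ℂ] E) (x y : E) : Prop :=
  Tendsto (fun h : ℝ => h⁻¹ • (T h x - x)) (𝓝[>] 0) (𝓝 y)

theorem HasGeneratorLimit.unique {E : Type*} [NormedAddCommGroup E] [NormedSpace ℂ E]
    {T : ℝ → E →L[ℂ] E} {x y z : E}
    (h1 : HasGeneratorLimit T x y) (h2 : HasGeneratorLimit T x z) : y = z :=
  tendsto_nhds_unique h1 h2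

theorem HasGeneratorLimit.zero {E : Type*} [NormedAddCommGroup E] [NormedSpace ℂ E]
    (T : ℝ → E →L[ℂ] E) : HasGeneratorLimit T 0 0 := by
  simp [HasGeneratorLimit]

theorem HasGeneratorLimit.add {E : Type*} [NormedAddCommGroup E] [NormedSpace ℂ E]
    {T : ℝ → E →L[ℂ] E} {x y x' y' : E}
    (h1 : HasGeneratorLimit T x y) (h2 : HasGeneratorLimit T x' y') :
    HasGeneratorLimit T (x + x') (y + y') := by
  refine (Tendsto.add h1 h2).congr fun h => ?_
  rw [← smul_add, map_add]
  congr 1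
  abel

theorem HasGeneratorLimit.smul {E : Type*} [NormedAddCommGroup E] [NormedSpace ℂ E]
    {T : ℝ → E →L[ℂ] E} {x y : E} (c : ℂ)
    (h1 : HasGeneratorLimit T x y) : HasGeneratorLimit T (c • x) (c • y) := by
  refine (Tendsto.const_smul h1 c).congr fun h => ?_
  rw [map_smul, ← smul_sub, smul_comm]

/-- The infinitesimal generator `A` of `T`: its domain `D(A)` is the set of those `x` for which
`lim_{h ↘ 0} (T(h)x - x)/h` exists, and `A x` is this limit. -/
noncomputable def generator {E : Type*} [NormedAddCommGroup E] [NormedSpace ℂ E]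
    (T : ℝ → E →L[ℂ] E) : E →ₗ.[ℂ] E where
  domain :=
    { carrier := {x | ∃ y, HasGeneratorLimit T x y}
      zero_mem' := ⟨0, HasGeneratorLimit.zero T⟩
      add_mem' := fun ⟨y, hy⟩ ⟨z, hz⟩ => ⟨y + z, hy.add hz⟩
      smul_mem' := fun c _ ⟨y, hy⟩ => ⟨c • y, hy.smul c⟩ }
  toFun :=
    { toFun := fun x => Classical.choose x.2
      map_add' := fun x y => (Classical.choose_spec (x + y).2).unique
        ((Classical.choose_spec x.2).add (Classical.choose_spec y.2))
      map_smul' := fun c x => (Classical.choose_spec (c • x).2).unique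
        ((Classical.choose_spec x.2).smul c) }

theorem generator_spec {E : Type*} [NormedAddCommGroup E] [NormedSpace ℂ E]
    (T : ℝ → E →L[ℂ] E) (x : (generator T).domain) :
    HasGeneratorLimit T x (generator T x) :=
  Classical.choose_spec x.2

open Classical in
/-- The inverse `B⁻¹ : E → E` of a linear operator `B : D(B) ⊆ E → E` which is a bijection
of `D(B)` onto `E` (and the junk value `0` if `B` is not such a bijection). -/
noncomputable def opInverse {E : Type*} [NormedAddCommGroup E] [NormedSpace ℂ E]
    (B : E →ₗ.[ℂ] E) : E →ₗ[ℂ] E :=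
  if h : Function.Bijective B.toFun then
    B.domain.subtype ∘ₗ (LinearEquiv.ofBijective B.toFun h).symm.toLinearMap
  else 0

/-- The operator `λ I - A`, with domain `D(A)`. -/
noncomputable def smulIdSub {E : Type*} [NormedAddCommGroup E] [NormedSpace ℂ E]
    (l : ℂ) (A : E →ₗ.[ℂ] E) : E →ₗ.[ℂ] E :=
  (l • (LinearMap.id : E →ₗ[ℂ] E)) +ᵥ (-A)

/-- The resolvent set `ρ(A)`: the `λ` such that `λ I - A : D(A) → E` is bijective. -/
def opResolventSet {E : Type*} [NormedAddCommGroup E] [NormedSpace ℂ E]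
    (A : E →ₗ.[ℂ] E) : Set ℂ :=
  {l | Function.Bijective (smulIdSub l A).toFun}

/-- The resolvent `R(λ; A) = (λ I - A)⁻¹`, for `λ ∈ ρ(A)`. -/
noncomputable def opResolvent {E : Type*} [NormedAddCommGroup E] [NormedSpace ℂ E]
    (l : ℂ) (A : E →ₗ.[ℂ] E) : E →ₗ[ℂ] E :=
  opInverse (smulIdSub l A)

open Classical in
/-- The operator `I - s A`. Its domain is `D(A)` for `s ≠ 0`; for `s = 0` it is
the identity operator, defined on all of `E` (`0 A` is the zero operator on `E`). -/
noncomputable def idSubSMul {E : Type*} [NormedAddCommGroup E] [NormedSpace ℂ E]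
    (s : ℂ) (A : E →ₗ.[ℂ] E) : E →ₗ.[ℂ] E :=
  if s = 0 then (LinearMap.id : E →ₗ[ℂ] E).toPMap ⊤
  else (LinearMap.id : E →ₗ[ℂ] E) +ᵥ (-(s • A))

/-! For `s > 0` with `s ω < 1`, the semigroup `u ↦ T(su)` has generator `sA` and growth exponent
below 1, so `J = (I - sA)⁻¹` is the Laplace integral `∫₀^∞ e^{-u} T(su) du`. With `s = t/n` the
theorem says that the implicit Euler scheme converges, which follows from stability, consistency and
density.

Stability: `T(r)` passes inside the integral, so `‖T(r) Jᵏ‖ ≤ M (1 - sω)⁻ᵏ e^{ωr}` with a single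
factor `M`. Consistency: for `z ∈ D(A)`, both `(T(s)z - z)/s` and `(Jz - z)/s = J(Az)` tend to `Az`,
so `T(s)z - Jz = o(s)`. Telescoping `T(s)ⁿ - Jⁿ` costs `n` such errors, in total `o(1)` since `ns ≤
b`. Stability extends this from the dense `D(A)` to `E`. -/

open MeasureTheory in
/-- The operator `x ↦ ∫₀^∞ e^{-u} T(u) x du`. -/
noncomputable def laplaceIntegral {E : Type*} [NormedAddCommGroup E] [NormedSpace ℂ E]
    (T : ℝ → E →L[ℂ] E) (x : E) : E :=
  ∫ u in Ioi (0 : ℝ), Real.exp (-u) • T u x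

/-! ### Rescaling and strong continuity of the semigroup. -/

section

variable {E : Type*} [NormedAddCommGroup E] [NormedSpace ℂ E]
  {M ω : ℝ} {T : ℝ → E →L[ℂ] E}

theorem IsSG.M_pos (hT : IsSG M ω T) : 0 < M := one_pos.trans_le hT.one_le

theorem IsSG.rescale (hT : IsSG M ω T) {s : ℝ} (hs : 0 < s) :
    IsSG M (s * ω) (fun u => T (s * u)) where
  isC0Semigroup :=
    { map_zero := by simpa using hT.isC0Semigroup.map_zero
      map_add := fun t r ht hr => by
        simpa [mul_add] using
          hT.isC0Semigroup.map_add (s * t) (s * r) (by positivity) (by positivity)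
      tendsto_zero := fun x => by
        refine (hT.isC0Semigroup.tendsto_zero x).comp ?_
        refine tendsto_nhdsWithin_iff.2 ⟨?_, ?_⟩
        · have : Continuous fun u : ℝ => s * u := by fun_prop
          simpa using (this.tendsto 0).mono_left nhdsWithin_le_nhds
        · filter_upwards [self_mem_nhdsWithin] with u hu
          exact mul_pos hs hu }
  one_le := hT.one_le
  nonneg := mul_nonneg hs.le hT.nonneg
  norm_le := fun t ht => by
    have := hT.norm_le (s * t) (by positivity)
    rwa [← mul_assoc, mul_comm ω s] at this

theorem HasGeneratorLimit.of_rescale {s : ℝ} (hs : 0 < s) {x y : E}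
    (h : HasGeneratorLimit (fun u => T (s * u)) x y) : HasGeneratorLimit T x (s⁻¹ • y) := by
  have h1 : Tendsto (fun u : ℝ => s⁻¹ * u) (𝓝[>] 0) (𝓝[>] 0) := by
    refine tendsto_nhdsWithin_iff.2 ⟨?_, ?_⟩
    · have : Continuous fun u : ℝ => s⁻¹ * u := by fun_prop
      simpa using (this.tendsto 0).mono_left nhdsWithin_le_nhds
    · filter_upwards [self_mem_nhdsWithin] with u hu
      exact mul_pos (inv_pos.2 hs) hu
  refine ((h.comp h1).const_smul s⁻¹).congr fun u => ?_
  simp only [Function.comp_apply, mul_inv_cancel_left₀ hs.ne', smul_smul, mul_inv, inv_inv]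
  rw [inv_mul_cancel_left₀ hs.ne']

theorem HasGeneratorLimit.rescale {s : ℝ} (hs : 0 < s) {x y : E}
    (h : HasGeneratorLimit T x y) : HasGeneratorLimit (fun u => T (s * u)) x (s • y) := by
  have := HasGeneratorLimit.of_rescale (T := fun u => T (s * u)) (s := s⁻¹) (inv_pos.2 hs)
    (x := x) (y := y) (by simpa [mul_inv_cancel_left₀ hs.ne'] using h)
  simpa using this

theorem IsSG.apply_add (hT : IsSG M ω T) {t s : ℝ} (ht : 0 ≤ t) (hs : 0 ≤ s) (x : E) :
    T (t + s) x = T t (T s x) := by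
  simp [hT.isC0Semigroup.map_add t s ht hs]

theorem IsSG.norm_apply_le (hT : IsSG M ω T) {t : ℝ} (ht : 0 ≤ t) (x : E) :
    ‖T t x‖ ≤ M * ‖x‖ * Real.exp (ω * t) :=
  ((T t).le_of_opNorm_le (hT.norm_le t ht) x).trans_eq (by ring)

theorem IsSG.apply_zero (hT : IsSG M ω T) (x : E) : T 0 x = x := by
  simp [hT.isC0Semigroup.map_zero]

theorem IsSG.continuousOn (hT : IsSG M ω T) (x : E) :
    ContinuousOn (fun t => T t x) (Ici 0) := by
  intro t (ht : 0 ≤ t)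
  have h0 : Tendsto (fun h : ℝ => T h x - x) (𝓝[≥] 0) (𝓝 0) := by
    rw [← Ioi_insert, nhdsWithin_insert, tendsto_sup]
    refine ⟨?_, ?_⟩
    · rw [tendsto_pure_left]
      intro s hs
      simpa [hT.apply_zero] using mem_of_mem_nhds hs
    · simpa using (hT.isC0Semigroup.tendsto_zero x).sub_const x
  have habs : Tendsto (fun r : ℝ => |r - t|) (𝓝[Ici 0] t) (𝓝[≥] 0) := by
    have : Continuous fun r : ℝ => |r - t| := by fun_prop
    have h := this.tendsto t
    simp only [sub_self, abs_zero] at h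
    exact tendsto_nhdsWithin_iff.2
      ⟨h.mono_left nhdsWithin_le_nhds, .of_forall fun r => abs_nonneg (r - t)⟩
  have h1 := (h0.comp habs).norm.const_mul (M * Real.exp (ω * t))
  simp only [norm_zero, mul_zero, Function.comp_apply] at h1
  refine tendsto_iff_norm_sub_tendsto_zero.2 (squeeze_zero' (.of_forall fun _ => norm_nonneg _) ?_ h1)
  filter_upwards [self_mem_nhdsWithin] with r (hr : 0 ≤ r)
  -- Factoring out the earlier time handles left and right continuity together.
  have key : ∀ a b : ℝ, 0 ≤ a → a ≤ b → a ≤ t →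
      ‖T b x - T a x‖ ≤ M * Real.exp (ω * t) * ‖T (b - a) x - x‖ := by
    intro a b ha hab hat
    have : T b x - T a x = T a (T (b - a) x - x) := by
      rw [map_sub, ← hT.apply_add ha (sub_nonneg.2 hab)]
      simp
    rw [this]
    refine (T a).le_of_opNorm_le ((hT.norm_le a ha).trans ?_) _
    have := hT.M_pos
    have := hT.nonneg
    gcongr
  rcases le_total r t with h | h
  · rw [norm_sub_rev, abs_sub_comm, abs_of_nonneg (sub_nonneg.2 h)]
    exact key r t hr h h
  · rw [abs_of_nonneg (sub_nonneg.2 h)]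
    exact key t r ht h le_rfl

open MeasureTheory

/-! ### The Laplace integral as the resolvent at 1. -/

theorem integrableOn_exp_growth (hω : ω < 1) (C : ℝ) :
    IntegrableOn (fun u => C * Real.exp ((ω - 1) * u)) (Ioi (0 : ℝ)) :=
  (integrableOn_exp_mul_Ioi (sub_neg.2 hω) 0).const_mul C

theorem integral_exp_growth (hω : ω < 1) (C : ℝ) :
    ∫ u in Ioi (0 : ℝ), C * Real.exp ((ω - 1) * u) = C / (1 - ω) := by
  rw [integral_const_mul, integral_exp_mul_Ioi (sub_neg.2 hω) 0]
  have : 1 - ω ≠ 0 := (sub_pos.2 hω).ne'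
  have : ω - 1 ≠ 0 := (sub_neg.2 hω).ne
  simp only [mul_zero, Real.exp_zero]
  field_simp
  ring

theorem norm_exp_smul_le {y : E} {C u : ℝ} (h : ‖y‖ ≤ C * Real.exp (ω * u)) :
    ‖Real.exp (-u) • y‖ ≤ C * Real.exp ((ω - 1) * u) := by
  rw [norm_smul, Real.norm_of_nonneg (Real.exp_pos _).le]
  calc Real.exp (-u) * ‖y‖ ≤ Real.exp (-u) * (C * Real.exp (ω * u)) := by gcongr
    _ = C * (Real.exp (-u) * Real.exp (ω * u)) := by ring
    _ = _ := by rw [← Real.exp_add]; ring_nf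

theorem IsSG.continuousOn_exp_smul (hT : IsSG M ω T) (x : E) :
    ContinuousOn (fun u => Real.exp (-u) • T u x) (Ici 0) :=
  (by fun_prop : Continuous fun u : ℝ => Real.exp (-u)).continuousOn.smul (hT.continuousOn x)

theorem IsSG.integrableOn (hT : IsSG M ω T) (hω : ω < 1) (x : E) :
    IntegrableOn (fun u => Real.exp (-u) • T u x) (Ioi 0) := by
  refine Integrable.mono' (integrableOn_exp_growth hω (M * ‖x‖))
    (((hT.continuousOn_exp_smul x).mono Ioi_subset_Ici_self).aestronglyMeasurable
      measurableSet_Ioi) ?_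
  filter_upwards [ae_restrict_mem measurableSet_Ioi] with u hu
  exact norm_exp_smul_le (hT.norm_apply_le (le_of_lt hu) x)

theorem norm_laplaceIntegral_le (hω : ω < 1) {x : E} {C : ℝ}
    (h : ∀ r, 0 ≤ r → ‖T r x‖ ≤ C * Real.exp (ω * r)) :
    ‖laplaceIntegral T x‖ ≤ C / (1 - ω) := by
  rw [← integral_exp_growth hω C]
  refine norm_integral_le_of_norm_le (integrableOn_exp_growth hω C) ?_
  filter_upwards [ae_restrict_mem measurableSet_Ioi] with u hu
  exact norm_exp_smul_le (h u (le_of_lt hu))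

/-- The bounded operator `x ↦ ∫₀^∞ e^{-u} T(u) x du`, for growth exponent `ω < 1`. -/
noncomputable def IsSG.laplaceMean (hT : IsSG M ω T) (hω : ω < 1) : E →L[ℂ] E :=
  LinearMap.mkContinuous
    { toFun := laplaceIntegral T
      map_add' := fun x y => by
        simp only [laplaceIntegral, map_add, smul_add]
        exact integral_add (hT.integrableOn hω x) (hT.integrableOn hω y)
      map_smul' := fun c x => by
        simp only [laplaceIntegral, map_smul, RingHom.id_apply]
        rw [← integral_smul]
        simp only [smul_comm c] }
    (M / (1 - ω)) fun x => by
      refine (norm_laplaceIntegral_le hω fun r hr => hT.norm_apply_le hr x).trans_eq ?_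
      ring

theorem IsSG.laplaceMean_apply (hT : IsSG M ω T) (hω : ω < 1) (x : E) :
    hT.laplaceMean hω x = ∫ u in Ioi (0 : ℝ), Real.exp (-u) • T u x := rfl

theorem hasGeneratorLimit_of_hasDerivAt {x y : E} {f : ℝ → E}
    (hf : HasDerivAt f y 0) (h0 : f 0 = x) (h : ∀ r, 0 ≤ r → T r x = f r) :
    HasGeneratorLimit T x y := by
  have h1 := (hasDerivWithinAt_iff_tendsto_slope' (self_notMem_Ioi)).1
    (hf.hasDerivWithinAt (s := Ioi 0))
  refine h1.congr' ?_
  filter_upwards [self_mem_nhdsWithin] with r hr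
  rw [slope_def_module, sub_zero, h0, h r (le_of_lt hr)]

variable [CompleteSpace E]

theorem IsSG.apply_laplaceMean (hT : IsSG M ω T) (hω : ω < 1) {r : ℝ} (hr : 0 ≤ r) (x : E) :
    T r (hT.laplaceMean hω x) = hT.laplaceMean hω (T r x) := by
  rw [laplaceMean_apply, laplaceMean_apply,
    ← ContinuousLinearMap.integral_comp_comm _ (hT.integrableOn hω x)]
  refine setIntegral_congr_fun measurableSet_Ioi fun u hu => ?_
  have hu' : 0 ≤ u := le_of_lt hu
  simp only [ContinuousLinearMap.map_smul_of_tower]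
  rw [← hT.apply_add hr hu', ← hT.apply_add hu' hr, add_comm]

/-- Carrying `T r` through the induction lets the next integral absorb it as `T (u + r)`; iterating
the operator norm bound would instead give `M ^ n`. -/
theorem IsSG.norm_apply_laplaceMean_pow_le (hT : IsSG M ω T) (hω : ω < 1) (x : E) (n : ℕ) :
    ∀ r, 0 ≤ r → ‖T r ((hT.laplaceMean hω ^ n) x)‖ ≤
      M * ‖x‖ / (1 - ω) ^ n * Real.exp (ω * r) := by
  induction n with
  | zero => intro r hr; simpa using hT.norm_apply_le hr x
  | succ n ih =>
    intro r hr
    rw [pow_succ', mul_apply_eq_comp, hT.apply_laplaceMean hω hr]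
    refine (norm_laplaceIntegral_le hω (T := T)
      (C := M * ‖x‖ / (1 - ω) ^ n * Real.exp (ω * r)) fun u hu => ?_).trans_eq ?_
    · rw [← hT.apply_add hu hr, mul_assoc, ← Real.exp_add]
      refine (ih (u + r) (by positivity)).trans_eq ?_
      ring_nf
    · rw [pow_succ, div_mul_eq_div_div]
      ring

/-- Substituting `u + h` for `u` turns the left side into `e^h ∫_h^∞ e^{-u} T(u)x du`. The `max u 0`
makes the integrand continuous on all of `ℝ`, so that the right side has a two-sided derivative at
`h = 0`. -/
theorem IsSG.apply_laplaceMean_eq (hT : IsSG M ω T) (hω : ω < 1) {h : ℝ} (hh : 0 ≤ h) (x : E) :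
    T h (hT.laplaceMean hω x) = Real.exp h •
      (hT.laplaceMean hω x - ∫ u in (0 : ℝ)..h, Real.exp (-u) • T (max u 0) x) := by
  have h1 : ∫ u in (0 : ℝ)..h, Real.exp (-u) • T (max u 0) x =
      ∫ u in (0 : ℝ)..h, Real.exp (-u) • T u x := by
    refine intervalIntegral.integral_congr fun u hu => ?_
    rw [uIcc_of_le hh] at hu
    simp [max_eq_left hu.1]
  have hi := hT.integrableOn hω x
  rw [h1, laplaceMean_apply, ← intervalIntegral.integral_interval_add_Ioi hi
    (hi.mono_set (Ioi_subset_Ioi hh)), add_sub_cancel_left,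
    intervalIntegral.integral_interval_add_Ioi hi (hi.mono_set (Ioi_subset_Ioi hh)),
    ← laplaceMean_apply hT hω, hT.apply_laplaceMean hω hh, laplaceMean_apply, ← integral_smul]
  have h2 := (measurePreserving_add_right volume h).setIntegral_preimage_emb
    (measurableEmbedding_addRight h) (fun u => Real.exp h • Real.exp (-u) • T u x) (Ioi h)
  rw [preimage_add_const_Ioi, sub_self] at h2
  rw [← h2]
  refine setIntegral_congr_fun measurableSet_Ioi fun u hu => ?_
  simp only [smul_smul, ← Real.exp_add]
  rw [← hT.apply_add (le_of_lt hu) hh]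
  ring_nf

theorem IsSG.hasGeneratorLimit_laplaceMean (hT : IsSG M ω T) (hω : ω < 1) (x : E) :
    HasGeneratorLimit T (hT.laplaceMean hω x) (hT.laplaceMean hω x - x) := by
  have hc : Continuous fun u : ℝ => Real.exp (-u) • T (max u 0) x := by
    refine (by fun_prop : Continuous fun u : ℝ => Real.exp (-u)).smul ?_
    exact (hT.continuousOn x).comp_continuous (by fun_prop) fun u => le_max_right u 0
  have hd := intervalIntegral.integral_hasDerivAt_right (hc.intervalIntegrable 0 0)
    (hc.stronglyMeasurableAtFilter _ _) hc.continuousAt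
  refine hasGeneratorLimit_of_hasDerivAt
    (f := fun h => Real.exp h •
      (hT.laplaceMean hω x - ∫ u in (0 : ℝ)..h, Real.exp (-u) • T (max u 0) x)) ?_ ?_ ?_
  · have h := (Real.hasDerivAt_exp 0).smul (hd.const_sub (hT.laplaceMean hω x))
    have hval : Real.exp 0 • -(Real.exp (-0) • T (max 0 0) x) +
        Real.exp 0 • (hT.laplaceMean hω x -
          ∫ u in (0 : ℝ)..0, Real.exp (-u) • T (max u 0) x) = hT.laplaceMean hω x - x := by
      simp [hT.apply_zero, sub_eq_neg_add]
    rw [hval] at h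
    exact h
  · simp
  · exact fun r hr => hT.apply_laplaceMean_eq hω hr x

/-- The mean commutes with difference quotients, hence with the generator; uniqueness of the
generator limit then gives the left inverse. -/
theorem IsSG.laplaceMean_sub_generatorLimit (hT : IsSG M ω T) (hω : ω < 1) {x y : E}
    (h : HasGeneratorLimit T x y) : hT.laplaceMean hω (x - y) = x := by
  have h1 : HasGeneratorLimit T (hT.laplaceMean hω x) (hT.laplaceMean hω y) := by
    refine (((hT.laplaceMean hω).continuous.tendsto y).comp h).congr' ?_
    filter_upwards [self_mem_nhdsWithin] with r hr
    simp only [Function.comp_apply, ContinuousLinearMap.map_smul_of_tower, map_sub]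
    rw [hT.apply_laplaceMean hω (le_of_lt hr)]
  have h2 := h1.unique (hT.hasGeneratorLimit_laplaceMean hω x)
  rw [map_sub, h2]
  abel

/-- As `s ↘ 0`, the means of the rescaled semigroups `u ↦ T(su)` tend to the identity. -/
theorem IsSG.tendsto_laplaceIntegral (hT : IsSG M ω T) (x : E) :
    Tendsto (fun s : ℝ => laplaceIntegral (fun u => T (s * u)) x) (𝓝[>] 0) (𝓝 x) := by
  have h1 : ∫ u in Ioi (0 : ℝ), Real.exp (-u) • x = x := by
    rw [integral_smul_const, integral_exp_neg_Ioi_zero, one_smul]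
  have hev : ∀ᶠ s : ℝ in 𝓝[>] 0, 0 < s ∧ s * ω ≤ 1 / 2 := by
    refine eventually_mem_nhdsWithin.and ?_
    have : Tendsto (fun s : ℝ => s * ω) (𝓝[>] 0) (𝓝 0) := by
      have : Continuous fun s : ℝ => s * ω := by fun_prop
      simpa using (this.tendsto 0).mono_left nhdsWithin_le_nhds
    exact this.eventually_le_const (by norm_num)
  conv in 𝓝 x => rw [← h1]
  refine tendsto_integral_filter_of_dominated_convergence
    (fun u => M * ‖x‖ * Real.exp ((1 / 2 - 1) * u)) ?_ ?_
    (integrableOn_exp_growth (by norm_num) _) ?_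
  · filter_upwards [hev] with s hs
    exact ((((hT.rescale hs.1).continuousOn_exp_smul x).mono
      Ioi_subset_Ici_self).aestronglyMeasurable measurableSet_Ioi)
  · filter_upwards [hev] with s hs
    filter_upwards [ae_restrict_mem measurableSet_Ioi] with u hu
    have hu' : 0 ≤ u := le_of_lt hu
    refine norm_exp_smul_le (((hT.rescale hs.1).norm_apply_le hu' x).trans ?_)
    have := hT.M_pos
    gcongr
    exact hs.2
  · filter_upwards [ae_restrict_mem measurableSet_Ioi] with u hu
    refine Tendsto.const_smul ?_ _
    refine (hT.isC0Semigroup.tendsto_zero x).comp (tendsto_nhdsWithin_iff.2 ⟨?_, ?_⟩)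
    · have : Continuous fun s : ℝ => s * u := by fun_prop
      simpa using (this.tendsto 0).mono_left nhdsWithin_le_nhds
    · filter_upwards [self_mem_nhdsWithin] with s hs
      exact mul_pos (mem_Ioi.1 hs) (mem_Ioi.1 hu)

end

/-! ### Inverses of unbounded operators and the Euler step. -/

section

variable {E : Type*} [NormedAddCommGroup E] [NormedSpace ℂ E]
  {M ω : ℝ} {T : ℝ → E →L[ℂ] E}

theorem bijective_and_opInverse_eq {B : E →ₗ.[ℂ] E} {J : E →ₗ[ℂ] E}
    (h1 : ∀ y, ∃ h : J y ∈ B.domain, B ⟨J y, h⟩ = y) (h2 : ∀ x : B.domain, J (B x) = x) :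
    Function.Bijective B.toFun ∧ opInverse B = J := by
  have hb : Function.Bijective B.toFun := by
    refine ⟨fun x y hxy => ?_, fun y => ⟨⟨J y, (h1 y).1⟩, (h1 y).2⟩⟩
    exact Subtype.ext ((h2 x).symm.trans ((congrArg J hxy).trans (h2 y)))
  refine ⟨hb, LinearMap.ext fun y => ?_⟩
  obtain ⟨x, rfl⟩ := hb.2 y
  rw [opInverse, dif_pos hb]
  have : (LinearEquiv.ofBijective B.toFun hb).symm (B.toFun x) = x :=
    (LinearEquiv.ofBijective B.toFun hb).symm_apply_apply x
  simp only [LinearMap.comp_apply, LinearEquiv.coe_coe, this]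
  exact (h2 x).symm

theorem HasGeneratorLimit.generator_apply {x y : E} (h : HasGeneratorLimit T x y) :
    ∃ hx : x ∈ (generator T).domain, generator T ⟨x, hx⟩ = y :=
  ⟨⟨y, h⟩, (generator_spec T ⟨x, ⟨y, h⟩⟩).unique h⟩

theorem inv_one_sub_le_exp {a : ℝ} (h0 : 0 ≤ a) (h1 : a ≤ 1 / 2) :
    (1 - a)⁻¹ ≤ Real.exp (2 * a) := by
  refine le_trans ?_ (Real.add_one_le_exp _)
  rw [inv_le_iff_one_le_mul₀ (by linarith)]
  nlinarith

variable [CompleteSpace E]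

/-- The implicit Euler step `(I - sA)⁻¹`. -/
noncomputable def IsSG.eulerStep (hT : IsSG M ω T) {s : ℝ} (hs : 0 < s) (hω : s * ω < 1) :
    E →L[ℂ] E :=
  (hT.rescale hs).laplaceMean hω

theorem IsSG.hasGeneratorLimit_eulerStep (hT : IsSG M ω T) {s : ℝ} (hs : 0 < s)
    (hω : s * ω < 1) (y : E) :
    HasGeneratorLimit T (hT.eulerStep hs hω y) (s⁻¹ • (hT.eulerStep hs hω y - y)) :=
  ((hT.rescale hs).hasGeneratorLimit_laplaceMean hω y).of_rescale hs

theorem IsSG.eulerStep_sub_smul (hT : IsSG M ω T) {s : ℝ} (hs : 0 < s)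
    (hω : s * ω < 1) {x y : E} (h : HasGeneratorLimit T x y) :
    hT.eulerStep hs hω (x - s • y) = x :=
  (hT.rescale hs).laplaceMean_sub_generatorLimit hω (h.rescale hs)

theorem IsSG.opInverse_idSubSMul (hT : IsSG M ω T) {s : ℝ} (hs : 0 < s) (hω : s * ω < 1) :
    Function.Bijective (idSubSMul (s : ℂ) (generator T)).toFun ∧
      opInverse (idSubSMul (s : ℂ) (generator T)) = (hT.eulerStep hs hω).toLinearMap := by
  have hs' : (s : ℂ) ≠ 0 := by exact_mod_cast hs.ne'
  rw [idSubSMul, if_neg hs']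
  refine bijective_and_opInverse_eq (fun y => ?_) fun x => ?_
  · obtain ⟨hx, hxy⟩ := (hT.hasGeneratorLimit_eulerStep hs hω y).generator_apply
    refine ⟨hx, ?_⟩
    rw [LinearPMap.vadd_apply, LinearPMap.neg_apply, LinearPMap.smul_apply]
    erw [hxy]
    simp [Complex.coe_smul, hs.ne']
  · rw [LinearPMap.vadd_apply, LinearPMap.neg_apply, LinearPMap.smul_apply]
    rw [LinearMap.id_apply, ← sub_eq_add_neg, Complex.coe_smul]
    exact hT.eulerStep_sub_smul hs hω (generator_spec T x)

/-- This is the factorization `s⁻¹ I - A = s⁻¹ (I - sA)`. -/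
theorem IsSG.opInverse_smulIdSub (hT : IsSG M ω T) {s : ℝ} (hs : 0 < s) (hω : s * ω < 1) :
    Function.Bijective (smulIdSub ((s⁻¹ : ℝ) : ℂ) (generator T)).toFun ∧
      opInverse (smulIdSub ((s⁻¹ : ℝ) : ℂ) (generator T)) =
        (s : ℂ) • (hT.eulerStep hs hω).toLinearMap := by
  unfold smulIdSub
  refine bijective_and_opInverse_eq (fun y => ?_) fun x => ?_
  · obtain ⟨hx, hxy⟩ :=
      ((hT.hasGeneratorLimit_eulerStep hs hω y).smul (s : ℂ)).generator_apply
    refine ⟨hx, ?_⟩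
    rw [LinearPMap.vadd_apply, LinearPMap.neg_apply]
    erw [hxy]
    rw [LinearMap.smul_apply, LinearMap.id_apply]
    simp only [LinearMap.smul_apply, ContinuousLinearMap.coe_coe, Complex.coe_smul,
      inv_smul_smul₀ hs.ne', smul_inv_smul₀ hs.ne']
    abel
  · rw [LinearPMap.vadd_apply, LinearPMap.neg_apply]
    rw [LinearMap.smul_apply, LinearMap.smul_apply, ← map_smul, LinearMap.id_apply,
      ← sub_eq_add_neg, Complex.coe_smul, Complex.coe_smul, smul_sub, smul_smul,
      mul_inv_cancel₀ hs.ne', one_smul]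
    exact hT.eulerStep_sub_smul hs hω (generator_spec T x)

/-! ### Stability, consistency and convergence. -/

theorem IsSG.norm_sub_laplaceMean_pow_le (hT : IsSG M ω T) (hω : ω < 1) (x : E) (n : ℕ) :
    ‖T n x - (hT.laplaceMean hω ^ n) x‖ ≤
      n * (M * ‖T 1 x - hT.laplaceMean hω x‖ / (1 - ω) ^ n * Real.exp (ω * n)) := by
  set J := hT.laplaceMean hω with hJ
  have hpow : ∀ k : ℕ, T 1 ^ k = T k := by
    intro k
    induction k with
    | zero => rw [pow_zero, Nat.cast_zero, hT.isC0Semigroup.map_zero]; rfl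
    | succ k ih =>
      rw [pow_succ, ih, Nat.cast_succ, hT.isC0Semigroup.map_add _ _ k.cast_nonneg one_pos.le]
      rfl
  have hcomm : Commute (T 1) J :=
    ContinuousLinearMap.ext fun y => hT.apply_laplaceMean hω one_pos.le y
  -- Telescoping: `T(1)ⁿ - Jⁿ = ∑ T(1)ⁱ Jⁿ⁻¹⁻ⁱ (T(1) - J)` for commuting operators.
  have hsum := congrArg (fun S : E →L[ℂ] E => S x) (hcomm.geom_sum₂_mul n)
  simp only [sub_apply, mul_apply_eq_comp, sum_apply,
    hpow] at hsum
  rw [← hsum]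
  refine (norm_sum_le _ _).trans ?_
  have hle : ∀ i ∈ Finset.range n, ‖T (i : ℝ) ((J ^ (n - 1 - i)) (T 1 x - J x))‖ ≤
      M * ‖T 1 x - J x‖ / (1 - ω) ^ n * Real.exp (ω * n) := by
    intro i hi
    have hin := Finset.mem_range.1 hi
    refine (hT.norm_apply_laplaceMean_pow_le hω _ _ i i.cast_nonneg).trans ?_
    have := hT.M_pos
    have := hT.nonneg
    have h1 : 0 < 1 - ω := sub_pos.2 hω
    have h2 : (1 - ω) ^ n ≤ (1 - ω) ^ (n - 1 - i) :=
      pow_le_pow_of_le_one h1.le (by linarith) (by omega)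
    gcongr
  simpa using Finset.sum_le_card_nsmul _ _ _ hle

/-- Growth factor estimate for the iterated Euler steps. -/
theorem inv_one_sub_pow_mul_exp_le (hω : 0 ≤ ω) {s : ℝ} (hs : 0 < s) (h : s * ω ≤ 1 / 2)
    {b : ℝ} {n : ℕ} (hn : n * s ≤ b) :
    ((1 - s * ω) ^ n)⁻¹ * Real.exp (s * ω * n) ≤ Real.exp (3 * ω * b) := by
  rw [← inv_pow]
  have h0 : 0 ≤ s * ω := by positivity
  calc (1 - s * ω)⁻¹ ^ n * Real.exp (s * ω * n)
      ≤ Real.exp (2 * (s * ω)) ^ n * Real.exp (s * ω * n) := by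
        have : 0 ≤ (1 - s * ω)⁻¹ := inv_nonneg.2 (by linarith)
        gcongr
        exact inv_one_sub_le_exp h0 h
    -- The 3 is 2 from `inv_one_sub_le_exp` plus 1 from the growth of the semigroup.
    _ = Real.exp (3 * ω * (n * s)) := by
        rw [← Real.exp_nat_mul, ← Real.exp_add]
        ring_nf
    _ ≤ _ := by gcongr

theorem IsSG.norm_sub_eulerStep_pow_le (hT : IsSG M ω T) {s : ℝ} (hs : 0 < s)
    (hω : s * ω < 1) (h : s * ω ≤ 1 / 2) {b : ℝ} {n : ℕ} (hn : n * s ≤ b) (x : E) :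
    ‖T (n * s) x - (hT.eulerStep hs hω ^ n) x‖ ≤
      n * (M * Real.exp (3 * ω * b) * ‖T s x - hT.eulerStep hs hω x‖) := by
  have h1 := (hT.rescale hs).norm_sub_laplaceMean_pow_le hω x n
  simp only [mul_one] at h1
  rw [mul_comm (n : ℝ) s]
  refine h1.trans ?_
  have h2 := inv_one_sub_pow_mul_exp_le hT.nonneg hs h hn
  have := hT.M_pos
  rw [show ∀ a b c d : ℝ, a * b / c * d = a * (c⁻¹ * d) * b by intros; ring]
  change _ ≤ n * (M * Real.exp (3 * ω * b) * ‖T s x - (hT.rescale hs).laplaceMean hω x‖)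
  gcongr

theorem IsSG.norm_eulerStep_pow_le (hT : IsSG M ω T) {s : ℝ} (hs : 0 < s)
    (hω : s * ω < 1) (h : s * ω ≤ 1 / 2) {b : ℝ} {n : ℕ} (hn : n * s ≤ b) (x : E) :
    ‖(hT.eulerStep hs hω ^ n) x‖ ≤ M * Real.exp (3 * ω * b) * ‖x‖ := by
  have h1 := (hT.rescale hs).norm_apply_laplaceMean_pow_le hω x n 0 le_rfl
  simp only [mul_zero, Real.exp_zero, mul_one, hT.apply_zero] at h1
  refine h1.trans ?_
  have h2 := inv_one_sub_pow_mul_exp_le hT.nonneg hs h hn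
  have h3 : 0 < 1 - s * ω := sub_pos.2 hω
  have h4 : ((1 - s * ω) ^ n)⁻¹ ≤ Real.exp (3 * ω * b) := by
    refine le_trans (le_mul_of_one_le_right (by positivity) (Real.one_le_exp ?_)) h2
    have := hT.nonneg
    positivity
  have := hT.M_pos
  rw [show ∀ a b c : ℝ, a * b / c = a * c⁻¹ * b by intros; ring]
  gcongr

/-- Consistency: `Jx = x + s J y`, so the error is `s` times the difference of two quantities that
both tend to `y`. -/
theorem IsSG.eventually_norm_sub_eulerStep_le (hT : IsSG M ω T) {x y : E}
    (h : HasGeneratorLimit T x y) {ε : ℝ} (hε : 0 < ε) :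
    ∀ᶠ s : ℝ in 𝓝[>] 0, ∀ (hs : 0 < s) (hω : s * ω < 1),
      ‖T s x - hT.eulerStep hs hω x‖ ≤ s * ε := by
  have h1 := (h.sub (hT.tendsto_laplaceIntegral y)).norm
  rw [sub_self, norm_zero] at h1
  filter_upwards [h1.eventually_le_const hε] with s h2 hs hω
  have h3 : T s x - hT.eulerStep hs hω x =
      s • (s⁻¹ • (T s x - x) - hT.eulerStep hs hω y) := by
    have h4 : hT.eulerStep hs hω x = x + s • hT.eulerStep hs hω y := by
      have := hT.eulerStep_sub_smul hs hω h
      rw [map_sub, ContinuousLinearMap.map_smul_of_tower, sub_eq_iff_eq_add] at this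
      exact this
    rw [smul_sub, smul_inv_smul₀ hs.ne', h4]
    abel
  rw [h3, norm_smul, Real.norm_of_nonneg hs.le]
  gcongr
  exact h2

theorem IsSG.dense_generator_domain (hT : IsSG M ω T) :
    Dense {x : E | ∃ y, HasGeneratorLimit T x y} := by
  intro x
  refine mem_closure_of_tendsto (hT.tendsto_laplaceIntegral x) ?_
  have : Tendsto (fun s : ℝ => s * ω) (𝓝[>] 0) (𝓝 0) := by
    have : Continuous fun s : ℝ => s * ω := by fun_prop
    simpa using (this.tendsto 0).mono_left nhdsWithin_le_nhds
  filter_upwards [this.eventually_lt_const one_pos, self_mem_nhdsWithin] with s hω hs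
  exact ⟨_, hT.hasGeneratorLimit_eulerStep hs hω x⟩

/-- Convergence of the implicit Euler scheme, uniformly for times in `(0, b]`. -/
theorem IsSG.eventually_norm_sub_eulerStep_pow_lt (hT : IsSG M ω T) (x : E) {b : ℝ}
    (hb : 0 < b) {ε : ℝ} (hε : 0 < ε) :
    ∀ᶠ n : ℕ in atTop, ∀ s : ℝ, 0 < s → n * s ≤ b → ∃ (hs : 0 < s) (hω : s * ω < 1),
      ‖T (n * s) x - (hT.eulerStep hs hω ^ n) x‖ < ε := by
  have hM := hT.M_pos
  set C := M * Real.exp (3 * ω * b) with hC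
  have hCpos : 0 < C := by positivity
  -- The three error terms below are each at most `ε / 4`, leaving room for strictness.
  obtain ⟨z, hz, y, hy⟩ := Metric.dense_iff.1 hT.dense_generator_domain x
    (ε / (4 * C)) (by positivity)
  have hz' : C * ‖x - z‖ < ε / 4 := by
    rw [mem_ball_iff_norm', lt_div_iff₀ (by positivity)] at hz
    linarith
  have hev : ∀ᶠ s : ℝ in 𝓝[>] 0, s * ω ≤ 1 / 2 ∧ ∀ (hs : 0 < s) (hω : s * ω < 1),
      ‖T s z - hT.eulerStep hs hω z‖ ≤ s * (ε / (4 * C * b)) := by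
    refine Eventually.and ?_ (hT.eventually_norm_sub_eulerStep_le hy (by positivity))
    have : Tendsto (fun s : ℝ => s * ω) (𝓝[>] 0) (𝓝 0) := by
      have : Continuous fun s : ℝ => s * ω := by fun_prop
      simpa using (this.tendsto 0).mono_left nhdsWithin_le_nhds
    exact this.eventually_le_const (by norm_num)
  obtain ⟨δ, hδ, hδs⟩ := mem_nhdsGT_iff_exists_Ioo_subset.1 hev
  have hδ : 0 < δ := hδ
  -- The source of uniformity: `n > b / δ` and `n * s ≤ b` force `s < δ` for all admissible `s` at
  -- once.
  filter_upwards [tendsto_natCast_atTop_atTop.eventually_gt_atTop (b / δ)] with n hn s hs hns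
  have hsδ : s < δ := by
    rw [div_lt_iff₀ hδ] at hn
    exact lt_of_mul_lt_mul_left (hns.trans_lt hn) n.cast_nonneg
  obtain ⟨h2, h3⟩ := hδs ⟨hs, hsδ⟩
  have hω : s * ω < 1 := by linarith
  refine ⟨hs, hω, ?_⟩
  set J := hT.eulerStep hs hω
  have e1 : ‖T (n * s) (x - z)‖ ≤ C * ‖x - z‖ := by
    refine (T _).le_of_opNorm_le ((hT.norm_le _ (by positivity)).trans ?_) _
    rw [hC]
    have := hT.nonneg
    gcongr
    nlinarith [mul_nonneg this hb.le, mul_le_mul_of_nonneg_left hns this]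
  have e2 : ‖(J ^ n) (z - x)‖ ≤ C * ‖x - z‖ := by
    rw [norm_sub_rev]
    exact hT.norm_eulerStep_pow_le hs hω h2 hns _
  have e3 : ‖T (n * s) z - (J ^ n) z‖ ≤ ε / 4 := by
    refine (hT.norm_sub_eulerStep_pow_le hs hω h2 hns z).trans ?_
    calc n * (C * ‖T s z - J z‖) ≤ n * (C * (s * (ε / (4 * C * b)))) := by
          have := h3 hs hω
          gcongr
      _ = (n * s) * (ε / (4 * b)) := by field_simp
      _ ≤ b * (ε / (4 * b)) := by gcongr
      _ = ε / 4 := by field_simp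
  have hsplit : T (n * s) x - (J ^ n) x =
      T (n * s) (x - z) + (T (n * s) z - (J ^ n) z) + (J ^ n) (z - x) := by
    simp only [map_sub]
    abel
  rw [hsplit]
  refine (norm_add₃_le).trans_lt ?_
  linarith

end

theorem bijective_idSubSMul_zero {E : Type*} [NormedAddCommGroup E] [NormedSpace ℂ E]
    (A : E →ₗ.[ℂ] E) : Function.Bijective (idSubSMul 0 A).toFun ∧
      opInverse (idSubSMul 0 A) = LinearMap.id := by
  rw [idSubSMul, if_pos rfl]
  exact bijective_and_opInverse_eq (fun y => ⟨trivial, rfl⟩) fun x => rfl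

theorem mainTheorem3 {E : Type*} [NormedAddCommGroup E] [NormedSpace ℂ E] [CompleteSpace E]
    (M ω : ℝ) (T : ℝ → E →L[ℂ] E) (hT : IsSG M ω T)
    (A : E →ₗ.[ℂ] E) (hA : A = generator T) :
    -- the inverses that occur in the formulas exist as soon as `n > ω t`
    (∀ (t : ℝ) (n : ℕ), 0 ≤ t → ω * t < n →
      Function.Bijective (idSubSMul ((t / n : ℝ) : ℂ) A).toFun ∧
      (0 < t → ((n / t : ℝ) : ℂ) ∈ opResolventSet A)) ∧
    -- `T(t)x = lim (I - (t/n)A)⁻ⁿ x`, uniformly in `t` on compact subsets of `[0,∞)`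
    (∀ (x : E) (K : Set ℝ), IsCompact K → K ⊆ Ici 0 →
      TendstoUniformlyOn
        (fun (n : ℕ) (t : ℝ) => (opInverse (idSubSMul ((t / n : ℝ) : ℂ) A) ^ n) x)
        (fun t => T t x) atTop K) ∧
    -- `T(t)x = lim [(n/t)R(n/t;A)]ⁿ x`, likewise (where `n/t` makes sense, i.e. `t ≠ 0`)
    (∀ (x : E) (K : Set ℝ), IsCompact K → K ⊆ Ici 0 →
      TendstoUniformlyOn
        (fun (n : ℕ) (t : ℝ) =>
          ((((n / t : ℝ) : ℂ) • opResolvent ((n / t : ℝ) : ℂ) A) ^ n) x)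
        (fun t => T t x) atTop (K \ {0})) := by
  subst hA
  have bound : ∀ K : Set ℝ, IsCompact K → ∃ b : ℝ, 0 < b ∧ ∀ t ∈ K, t ≤ b := by
    intro K hK
    obtain ⟨b, hb⟩ := hK.bddAbove
    exact ⟨max b 1, by positivity, fun t ht => (hb ht).trans (le_max_left _ _)⟩
  refine ⟨fun t n ht hn => ?_, fun x K hK hK0 => ?_, fun x K hK hK0 => ?_⟩
  · have hn0 : (0 : ℝ) < n := (mul_nonneg hT.nonneg ht).trans_lt hn
    rcases ht.eq_or_lt with rfl | ht
    · refine ⟨?_, fun h => (lt_irrefl _ h).elim⟩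
      rw [zero_div, Complex.ofReal_zero]
      exact (bijective_idSubSMul_zero (generator T)).1
    · have hs : 0 < t / n := div_pos ht hn0
      have hω : t / n * ω < 1 := by
        rw [div_mul_eq_mul_div, div_lt_one hn0]
        linarith
      refine ⟨(hT.opInverse_idSubSMul hs hω).1, fun _ => ?_⟩
      rw [← inv_div t (n : ℝ)]
      exact (hT.opInverse_smulIdSub hs hω).1
  · obtain ⟨b, hb, hKb⟩ := bound K hK
    refine Metric.tendstoUniformlyOn_iff.2 fun ε hε => ?_
    filter_upwards [hT.eventually_norm_sub_eulerStep_pow_lt x hb hε, eventually_gt_atTop 0]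
      with n h hn t ht
    have hn0 : (0 : ℝ) < n := Nat.cast_pos.2 hn
    rcases (mem_Ici.1 (hK0 ht)).eq_or_lt with rfl | ht0
    · rw [zero_div, Complex.ofReal_zero, (bijective_idSubSMul_zero (generator T)).2,
        hT.apply_zero, ← Module.End.one_eq_id, one_pow]
      simpa using hε
    · have hnt : n * (t / n) = t := mul_div_cancel₀ t hn0.ne'
      obtain ⟨hs, hω, hlt⟩ := h (t / n) (div_pos ht0 hn0) (hnt.trans_le (hKb t ht))
      rw [hnt] at hlt
      rw [(hT.opInverse_idSubSMul hs hω).2, ← ContinuousLinearMap.toLinearMap_pow, dist_eq_norm]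
      exact hlt
  · obtain ⟨b, hb, hKb⟩ := bound K hK
    refine Metric.tendstoUniformlyOn_iff.2 fun ε hε => ?_
    filter_upwards [hT.eventually_norm_sub_eulerStep_pow_lt x hb hε, eventually_gt_atTop 0]
      with n h hn t ht
    have hn0 : (0 : ℝ) < n := Nat.cast_pos.2 hn
    have ht0 : 0 < t := lt_of_le_of_ne (hK0 ht.1) (Ne.symm ht.2)
    have hnt : n * (t / n) = t := mul_div_cancel₀ t hn0.ne'
    obtain ⟨hs, hω, hlt⟩ := h (t / n) (div_pos ht0 hn0) (hnt.trans_le (hKb t ht.1))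
    rw [hnt] at hlt
    -- With `s = t / n`, the factor `n / t = s⁻¹` cancels the `s` in the resolvent, leaving the same
    -- Euler step.
    rw [← inv_div t (n : ℝ), opResolvent, (hT.opInverse_smulIdSub hs hω).2, smul_smul,
      ← Complex.ofReal_mul, inv_mul_cancel₀ hs.ne', Complex.ofReal_one, one_smul,
      ← ContinuousLinearMap.toLinearMap_pow, dist_eq_norm]
    exact hlt
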